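/- Theorem. Let a channel state evolve as a two-state (Good/Bad) Gilbert–Elliott Markov chain with transition probabilities $\alpha\in[0,1]$ from Good to Bad and $\beta\in[0,1]$ from Bad to Good, and let $(p,q)=\left(\frac{\beta}{\alpha+\beta},\frac{\alpha}{\alpha+\beta}\right)$ be its stationary distribution, where $p,q\neq 0$. Let $F_g$ and $F_b$ be the distribution functions of the Gaussian laws with means $\mu_g,\mu_b\in\mathbb{R}$ and standard deviations $\sigma_g,\sigma_b>0$, where either $\sigma_g>\sigma_b$, or $\sigma_g=\sigma_b$ and $\mu_g>\mu_b$. Let $C_1,C_2,\dots$ (the users' capacities in a time slot) be independent real random variables on a probability space, each with the stationary marginal distribution function $F=pF_g+qF_b$, and let $M_K=\max\{C_1,\dots,C_K\}$. For $K\ge 2$ put $$a_K=\frac{\sqrt{2\log K}}{\sigma_g},\qquad b_K=\sigma_g\left(\sqrt{2\log K}-\frac{\log\log K+\log\frac{4\pi}{p^2}}{2\sqrt{2\log K}}\right)+\mu_g .$$ Then the normalized maximum converges in distribution to the Gumbel law: for every $x\in\mathbb{R}$, $$P\left(a_K(M_K-b_K)\le x\right)\longrightarrow e^{-e^{-x}}\qquad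 (K\to\infty).$$ Moreover, every $M_K$ is integrable and the expected capacity of the scheduled user satisfies $$E[M_K]=b_K+\frac{\gamma}{a_K}+o\left(\frac{1}{a_K}\right)\qquad (K\to\infty),$$ where $\gamma$ is the Euler–Mascheroni constant. -/

import Mathlib

open MeasureTheory ProbabilityTheory Filter Topology Asymptotics

namespace GilbertElliott

/-- The two states of the channel of a user. -/
inductive ChannelState where
  | good : ChannelState
  | bad : ChannelState

/-- One-step transition probabilities of the channel state: good to bad with probability `α`,
bad to good with probability `β`. -/
def transition (α β : ℝ) : ChannelState → ChannelState → ℝ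
  | .good, .good => 1 - α
  | .good, .bad => α
  | .bad, .good => β
  | .bad, .bad => 1 - β

/-- The stationary distribution `(β / (α + β), α / (α + β))` of the channel state. -/
noncomputable def stationary (α β : ℝ) : ChannelState → ℝ
  | .good => β / (α + β)
  | .bad => α / (α + β)

/-- `stationary α β` is the one and only probability vector that is invariant under
`transition α β`. -/
theorem stationary_spec {α β : ℝ} (h : α + β ≠ 0) (w : ChannelState → ℝ) :
    (w .good + w .bad = 1 ∧
      ∀ t, w .good * transition α β .good t + w .bad * transition α β .bad t = w t) ↔
      w = stationary α β := by
  constructor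
  · rintro ⟨h1, h2⟩
    have h3 := h2 .good
    simp only [transition] at h3
    funext t
    cases t
    · rw [stationary, eq_div_iff h]
      linear_combination (-1 : ℝ) * h3 + β * h1
    · rw [stationary, eq_div_iff h]
      linear_combination h3 + α * h1
  · rintro rfl
    refine ⟨?_, fun t => ?_⟩
    · simp only [stationary]
      field_simp
      ring
    · cases t <;> simp only [stationary, transition] <;> field_simp <;> ring

/-- The distribution function of the Gaussian law with mean `m` and standard deviation `s`. -/
noncomputable def gaussianCDF (m s : ℝ) (x : ℝ) : ℝ :=
  cdf (gaussianReal m ⟨s ^ 2, sq_nonneg s⟩) x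

/-- The stationary marginal distribution function `F = p F_g + q F_b` of the capacity of a user. -/
noncomputable def capacityCDF (α β μg μb σg σb : ℝ) (x : ℝ) : ℝ :=
  stationary α β .good * gaussianCDF μg σg x + stationary α β .bad * gaussianCDF μb σb x

/-- The largest of the first `K` capacities (meant for `1 ≤ K`). -/
noncomputable def maxCapacity {Ω : Type*} (C : ℕ → Ω → ℝ) (K : ℕ) (ω : Ω) : ℝ :=
  ⨆ i : Fin K, C i ω

/-- The normalizing constant `a_K`. -/
noncomputable def scaleConst (σg : ℝ) (K : ℕ) : ℝ :=
  √(2 * Real.log K) / σg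

/-- The normalizing constant `b_K`, where `p` is the stationary probability of the good state. -/
noncomputable def locConst (p μg σg : ℝ) (K : ℕ) : ℝ :=
  σg * (√(2 * Real.log K)
    - (Real.log (Real.log K) + Real.log (4 * Real.pi / p ^ 2)) / (2 * √(2 * Real.log K))) + μg

end GilbertElliott

/-! Write s = √(2 log K), so K = exp(s²/2), and let H be the tail of F at μg + σg z. The bad state
has a negligible tail, so H is asymptotic to ρ times `gaussianTail`, with ρ = p/√(2π). Let c = 1/ρ.
The constants are chosen so that b_K + t/a_K is exactly μg + σg z_t with z_t = s + (t - log(sc))/s.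
Completing the square and Mills' ratio give K H(z_t) → exp(-t) (`tendsto_exp_mul_tail`). By
independence the normalized maximum X_K has distribution function (1 - H(z_t))^K, which therefore
tends to exp(-exp(-t)).

Convergence in law does not by itself give convergence of means, so E[X_K] is written as the
difference of its two tail integrals and each is passed to the limit by dominated convergence.
Above, P(X_K > t) ≤ K H(z_t) ≤ A exp(-t/2). Below, (1 - H)^K ≤ exp(-K H) is at most
exp(-exp(t/2)/2), but only for t ≤ s²/4. Further out, K - 1 factors are frozen at t = s²/4, where
their product is doubly exponentially small in s, and the last factor is integrated at a cost of
order s². The limit is the Gumbel mean: -log of a standard exponential variable is Gumbel, and its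
mean is -Γ'(1) = γ. -/

namespace GilbertElliott

/-! ### Tail integrals of signed random variables -/

/-- The lower tail of an integrable random variable is integrable, with integral at most the
first absolute moment. -/
theorem integrableOn_lower_tail {Ω : Type*} [MeasurableSpace Ω] {P : Measure Ω}
    [IsProbabilityMeasure P] {X : Ω → ℝ} (hX : Integrable X P) :
    IntegrableOn (fun t : ℝ => P.real {ω | X ω ≤ -t}) (Set.Ioi 0) ∧
      ∫ t in Set.Ioi (0 : ℝ), P.real {ω | X ω ≤ -t} ≤ ∫ ω, |X ω| ∂P := by
  have hneg : Integrable (fun ω => max (-X ω) 0) P := hX.neg.pos_part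
  have hset : ∀ t ∈ Set.Ioi (0 : ℝ), {ω | X ω ≤ -t} = {ω | t ≤ max (-X ω) 0} := by
    intro t ht
    ext ω
    simp only [Set.mem_ofPred_eq, le_max_iff, not_le.mpr (Set.mem_Ioi.mp ht), or_false]
    exact le_neg
  have hnn : 0 ≤ᵐ[P] fun ω => max (-X ω) 0 := Eventually.of_forall fun ω => le_max_right _ _
  refine ⟨⟨?_, ?_⟩, ?_⟩
  · have hanti : Antitone (fun t : ℝ => P.real {ω | X ω ≤ -t}) := fun a b hab =>
      measureReal_mono fun ω (h : X ω ≤ -b) => show X ω ≤ -a by linarith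
    exact hanti.measurable.aestronglyMeasurable
  · have key := lintegral_eq_lintegral_meas_le P hnn hneg.aemeasurable
    rw [hasFiniteIntegral_iff_ofReal (Eventually.of_forall fun t => measureReal_nonneg)]
    calc ∫⁻ t in Set.Ioi (0 : ℝ), ENNReal.ofReal (P.real {ω | X ω ≤ -t})
        = ∫⁻ t in Set.Ioi (0 : ℝ), P {ω | t ≤ max (-X ω) 0} := by
          refine setLIntegral_congr_fun measurableSet_Ioi fun t ht => ?_
          rw [← hset t ht]
          exact ofReal_measureReal
      _ < ⊤ := by
          rw [← key]
          exact hneg.lintegral_lt_top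
  · calc ∫ t in Set.Ioi (0 : ℝ), P.real {ω | X ω ≤ -t}
        = ∫ t in Set.Ioi (0 : ℝ), P.real {ω | t ≤ max (-X ω) 0} :=
          setIntegral_congr_fun measurableSet_Ioi fun t ht => by
            simp only [hset t ht]
      _ = ∫ ω, max (-X ω) 0 ∂P := (hneg.integral_eq_integral_meas_le hnn).symm
      _ ≤ ∫ ω, |X ω| ∂P := integral_mono hneg hX.abs fun ω =>
          max_le (neg_le_abs _) (abs_nonneg _)

/-- The layer cake formula for a signed integrable random variable. -/
theorem integral_eq_upper_tail_sub_lower_tail {Ω : Type*} [MeasurableSpace Ω] {P : Measure Ω}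
    {X : Ω → ℝ} (hX : Integrable X P) :
    ∫ ω, X ω ∂P = (∫ t in Set.Ioi (0 : ℝ), P.real {ω | t < X ω})
      - ∫ t in Set.Ioi (0 : ℝ), P.real {ω | X ω ≤ -t} := by
  have hpos : Integrable (fun ω => max (X ω) 0) P := hX.pos_part
  have hneg : Integrable (fun ω => max (-X ω) 0) P := hX.neg.pos_part
  have h1 : ∫ ω, X ω ∂P = (∫ ω, max (X ω) 0 ∂P) - ∫ ω, max (-X ω) 0 ∂P := by
    rw [← integral_sub hpos hneg]
    refine integral_congr_ae (Eventually.of_forall fun ω => ?_)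
    rcases le_total 0 (X ω) with h | h
    · simp [h]
    · simp [h]
  rw [h1, hpos.integral_eq_integral_meas_lt (Eventually.of_forall fun ω => le_max_right _ _),
    hneg.integral_eq_integral_meas_le (Eventually.of_forall fun ω => le_max_right _ _)]
  congr 1
  · refine setIntegral_congr_fun measurableSet_Ioi fun t ht => ?_
    have ht : 0 < t := ht
    simp only [lt_max_iff, not_lt.mpr ht.le, or_false]
  · refine setIntegral_congr_fun measurableSet_Ioi fun t ht => ?_
    have ht : 0 < t := ht
    simp only [le_max_iff, not_le.mpr ht, or_false, le_neg]

/-! ### The Gumbel mean and convergence of means -/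

/-- Differentiating Euler's integral under the integral sign at 1 identifies the left side with
Γ'(1). -/
theorem integral_log_mul_exp_neg :
    ∫ t in Set.Ioi (0 : ℝ), Real.log t * Real.exp (-t) = -Real.eulerMascheroniConstant := by
  have h1 := Complex.hasDerivAt_GammaIntegral (s := 1) (by simp)
  have h2 : HasDerivAt Complex.GammaIntegral (-Real.eulerMascheroniConstant) 1 := by
    refine Complex.hasDerivAt_Gamma_one.congr_of_eventuallyEq ?_
    have hopen : IsOpen {z : ℂ | 0 < z.re} := isOpen_lt continuous_const Complex.continuous_re
    filter_upwards [hopen.mem_nhds (show (1 : ℂ) ∈ {z : ℂ | 0 < z.re} by simp)] with z hz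
    exact (Complex.Gamma_eq_integral hz).symm
  have h3 := h1.unique h2
  have h4 : (∫ t : ℝ in Set.Ioi 0,
      (t : ℂ) ^ ((1 : ℂ) - 1) * ((Real.log t : ℂ) * (Real.exp (-t) : ℂ)))
      = ((∫ t in Set.Ioi (0 : ℝ), Real.log t * Real.exp (-t) : ℝ) : ℂ) := by
    rw [← integral_complex_ofReal]
    refine integral_congr_ae (Eventually.of_forall fun t => ?_)
    simp
  rw [h4] at h3
  exact_mod_cast h3

theorem integral_expMeasure_one (f : ℝ → ℝ) :
    ∫ x, f x ∂(expMeasure 1) = ∫ x in Set.Ioi (0 : ℝ), f x * Real.exp (-x) := by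
  have hpdf : ∀ x, (exponentialPDF 1 x).toReal = exponentialPDFReal 1 x := fun x =>
    ENNReal.toReal_ofReal (exponentialPDFReal_nonneg one_pos x)
  have hdef : expMeasure 1 = volume.withDensity (exponentialPDF 1) := rfl
  have hmeas : Measurable (exponentialPDF 1) :=
    (measurable_exponentialPDFReal 1).ennreal_ofReal
  rw [hdef, integral_withDensity_eq_integral_toReal_smul hmeas
    (Eventually.of_forall fun x => ENNReal.ofReal_lt_top), ← integral_Ici_eq_integral_Ioi,
    ← integral_indicator measurableSet_Ici]
  refine integral_congr_ae (Eventually.of_forall fun x => ?_)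
  simp only [hpdf, smul_eq_mul]
  by_cases hx : x ∈ Set.Ici (0 : ℝ)
  · rw [Set.indicator_of_mem hx]
    have hx' : (0 : ℝ) ≤ x := hx
    simp [exponentialPDFReal, gammaPDFReal, hx', mul_comm]
  · rw [Set.indicator_of_notMem hx]
    have hx' : ¬ (0 : ℝ) ≤ x := hx
    simp [exponentialPDFReal, gammaPDFReal, hx']

/-- The mean of the Gumbel law, through its two tails. -/
theorem gumbel_tails_eq_eulerMascheroniConstant :
    (∫ t in Set.Ioi (0 : ℝ), (1 - Real.exp (-Real.exp (-t))))
      - ∫ t in Set.Ioi (0 : ℝ), Real.exp (-Real.exp t) = Real.eulerMascheroniConstant := by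
  have : IsProbabilityMeasure (expMeasure 1) := isProbabilityMeasure_expMeasure one_pos
  have hval : ∫ x, -Real.log x ∂(expMeasure 1) = Real.eulerMascheroniConstant := by
    rw [integral_expMeasure_one]
    simp only [neg_mul]
    rw [integral_neg, integral_log_mul_exp_neg, neg_neg]
  have hint : Integrable (fun x => -Real.log x) (expMeasure 1) := by
    -- A non-integrable function has integral 0 by convention, whereas γ > 1/2.
    by_contra h
    rw [integral_undef h] at hval
    linarith [Real.one_half_lt_eulerMascheroniConstant]
  have hcdf : ∀ x : ℝ, 0 ≤ x → (expMeasure 1).real (Set.Iic x) = 1 - Real.exp (-x) := by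
    intro x hx
    rw [← cdf_eq_real, cdf_expMeasure_eq one_pos, if_pos hx, one_mul]
  have hpos : ∀ᵐ x ∂(expMeasure 1), 0 < x := by
    have h0 := hcdf 0 le_rfl
    rw [neg_zero, Real.exp_zero, sub_self, measureReal_eq_zero_iff] at h0
    filter_upwards [measure_eq_zero_iff_ae_notMem.mp h0] with x hx
    simpa using hx
  -- Absence of atoms allows strict and weak inequalities to be exchanged below.
  have hsingle : ∀ y, expMeasure 1 {y} = 0 := fun y =>
    withDensity_absolutelyContinuous volume (gammaPDF 1 1) (measure_singleton y)
  rw [← hval, integral_eq_upper_tail_sub_lower_tail hint]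
  congr 1
  · refine setIntegral_congr_fun measurableSet_Ioi fun t _ => ?_
    rw [← hcdf _ (Real.exp_pos _).le]
    refine measureReal_congr ?_
    filter_upwards [hpos, measure_eq_zero_iff_ae_notMem.mp (hsingle (Real.exp (-t)))] with x hx hx'
    refine propext ?_
    change x ≤ Real.exp (-t) ↔ t < -Real.log x
    rw [lt_neg, Real.log_lt_iff_lt_exp hx]
    exact ⟨fun h => lt_of_le_of_ne h hx', le_of_lt⟩
  · refine setIntegral_congr_fun measurableSet_Ioi fun t _ => ?_
    have h1 : Real.exp (-Real.exp t) = (expMeasure 1).real (Set.Iic (Real.exp t))ᶜ := by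
      rw [probReal_compl_eq_one_sub measurableSet_Iic, hcdf _ (Real.exp_pos _).le, sub_sub_cancel]
    rw [h1]
    refine measureReal_congr ?_
    filter_upwards [hpos, measure_eq_zero_iff_ae_notMem.mp (hsingle (Real.exp t))] with x hx hx'
    refine propext ?_
    change ¬ x ≤ Real.exp t ↔ -Real.log x ≤ -t
    rw [neg_le_neg_iff, Real.le_log_iff_exp_le hx, not_le]
    exact ⟨le_of_lt, fun h => lt_of_le_of_ne h (Ne.symm hx')⟩

/-- Dominated convergence on each tail. The lower bound is required only up to a moving cutoff `T
K`; the mass beyond it is handled by `hrem`. -/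
theorem tendsto_integral_eulerMascheroniConstant {Ω : Type*} [MeasurableSpace Ω] {P : Measure Ω}
    [IsProbabilityMeasure P] {X : ℕ → Ω → ℝ} (hX : ∀ K, Integrable (X K) P)
    (hlim : ∀ x : ℝ, Tendsto (fun K => P.real {ω | X K ω ≤ x}) atTop
      (𝓝 (Real.exp (-Real.exp (-x)))))
    {A c : ℝ} (hc : 0 < c) {T : ℕ → ℝ} (hT : Tendsto T atTop atTop)
    (hup : ∀ᶠ K in atTop, ∀ t, 0 ≤ t → P.real {ω | t < X K ω} ≤ A * Real.exp (-(t / 2)))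
    (hlow : ∀ᶠ K in atTop, ∀ t, 0 ≤ t → t ≤ T K →
      P.real {ω | X K ω ≤ -t} ≤ Real.exp (-(c * Real.exp (t / 2))))
    (hrem : Tendsto (fun K => ∫ t in Set.Ioi (T K), P.real {ω | X K ω ≤ -t}) atTop (𝓝 0)) :
    Tendsto (fun K => ∫ ω, X K ω ∂P) atTop (𝓝 Real.eulerMascheroniConstant) := by
  have hmeas : ∀ K x, NullMeasurableSet {ω | X K ω ≤ x} P := fun K x =>
    nullMeasurableSet_le (hX K).aemeasurable aemeasurable_const
  have hcompl : ∀ K x, P.real {ω | x < X K ω} = 1 - P.real {ω | X K ω ≤ x} := fun K x => by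
    rw [← probReal_compl_eq_one_sub₀ (hmeas K x)]
    congr 1
    ext ω
    simp
  have hanti : ∀ K, Antitone (fun t : ℝ => P.real {ω | X K ω ≤ -t}) := fun K a b hab =>
      measureReal_mono fun ω (h : X K ω ≤ -b) => show X K ω ≤ -a by linarith
  have hanti' : ∀ K, Antitone (fun t : ℝ => P.real {ω | t < X K ω}) := fun K a b hab =>
      measureReal_mono fun ω (h : b < X K ω) => show a < X K ω by linarith
  have hexp : IntegrableOn (fun t : ℝ => Real.exp (-(t / 2))) (Set.Ioi 0) := by
    have := integrableOn_exp_mul_Ioi (a := -(1 / 2 : ℝ)) (by norm_num) 0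
    refine this.congr_fun (fun t _ => ?_) measurableSet_Ioi
    simp only
    congr 1
    ring
  have hupper : Tendsto (fun K => ∫ t in Set.Ioi (0 : ℝ), P.real {ω | t < X K ω}) atTop
      (𝓝 (∫ t in Set.Ioi (0 : ℝ), (1 - Real.exp (-Real.exp (-t))))) := by
    refine tendsto_integral_filter_of_dominated_convergence
      (fun t => A * Real.exp (-(t / 2))) ?_ ?_ (hexp.const_mul A) ?_
    · exact Eventually.of_forall fun K => (hanti' K).measurable.aestronglyMeasurable
    · filter_upwards [hup] with K hK
      refine (ae_restrict_iff' measurableSet_Ioi).mpr (Eventually.of_forall fun t ht => ?_)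
      rw [Real.norm_of_nonneg measureReal_nonneg]
      exact hK t (le_of_lt ht)
    · refine Eventually.of_forall fun t => ?_
      simp only [hcompl]
      exact (hlim t).const_sub 1
  -- The indicator confines the integrand to the range of `hlow`; at each fixed t it is eventually
  -- 1.
  have hlower : Tendsto (fun K => ∫ t in Set.Ioi (0 : ℝ),
      (Set.Iic (T K)).indicator (fun t => P.real {ω | X K ω ≤ -t}) t) atTop
      (𝓝 (∫ t in Set.Ioi (0 : ℝ), Real.exp (-Real.exp t))) := by
    refine tendsto_integral_filter_of_dominated_convergence
      (fun t => (1 / c) * Real.exp (-(t / 2))) ?_ ?_ (hexp.const_mul _) ?_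
    · exact Eventually.of_forall fun K =>
        ((hanti K).measurable.indicator measurableSet_Iic).aestronglyMeasurable
    · filter_upwards [hlow] with K hK
      refine (ae_restrict_iff' measurableSet_Ioi).mpr (Eventually.of_forall fun t ht => ?_)
      by_cases htT : t ∈ Set.Iic (T K)
      · rw [Set.indicator_of_mem htT, Real.norm_of_nonneg measureReal_nonneg]
        refine (hK t (le_of_lt ht) htT).trans ?_
        -- This is exp(-y) ≤ 1/y with y = c exp(t/2).
        rw [Real.exp_neg, Real.exp_neg, one_div, ← mul_inv]
        refine inv_anti₀ (by positivity) ?_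
        linarith [Real.add_one_le_exp (c * Real.exp (t / 2))]
      · rw [Set.indicator_of_notMem htT, norm_zero]
        positivity
    · refine Eventually.of_forall fun t => ?_
      have := hlim (-t)
      rw [neg_neg] at this
      refine this.congr' ?_
      filter_upwards [hT.eventually_ge_atTop t] with K hK
      rw [Set.indicator_of_mem (Set.mem_Iic.mpr hK)]
  rw [← gumbel_tails_eq_eulerMascheroniConstant]
  have hsum := hupper.sub (hlower.add hrem)
  rw [add_zero] at hsum
  refine hsum.congr' ?_
  filter_upwards [hT.eventually_ge_atTop 0] with K hK
  rw [integral_eq_upper_tail_sub_lower_tail (hX K)]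
  congr 1
  have hint := (integrableOn_lower_tail (hX K)).1
  rw [← Set.Ioc_union_Ioi_eq_Ioi hK, setIntegral_union (Set.Ioc_disjoint_Ioi le_rfl)
    measurableSet_Ioi (hint.mono_set Set.Ioc_subset_Ioi_self)
    (hint.mono_set (Set.Ioi_subset_Ioi hK)), Set.Ioc_union_Ioi_eq_Ioi hK,
    setIntegral_indicator measurableSet_Iic, Set.Ioi_inter_Iic]

/-! ### Gaussian tails -/

/-- The tail of the unnormalised standard Gaussian density. -/
noncomputable def gaussianTail (z : ℝ) : ℝ :=
  ∫ u in Set.Ioi z, Real.exp (-(u ^ 2 / 2))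

theorem integrable_exp_neg_sq_half : Integrable (fun u : ℝ => Real.exp (-(u ^ 2 / 2))) := by
  have h := integrable_exp_neg_mul_sq (b := 1 / 2) (by norm_num)
  refine h.congr (Eventually.of_forall fun u => ?_)
  simp only
  congr 1
  ring

theorem integral_Ioi_comp_add_left (f : ℝ → ℝ) (a z : ℝ) :
    ∫ r in Set.Ioi a, f (z + r) = ∫ u in Set.Ioi (z + a), f u := by
  rw [← integral_indicator measurableSet_Ioi, ← integral_indicator measurableSet_Ioi,
    ← integral_add_left_eq_self ((Set.Ioi (z + a)).indicator f) z]
  refine integral_congr_ae (Eventually.of_forall fun r => ?_)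
  simp [Set.indicator]

theorem gaussianTail_eq (z : ℝ) :
    gaussianTail z = ∫ r in Set.Ioi (0 : ℝ), Real.exp (-((z + r) ^ 2 / 2)) := by
  rw [integral_Ioi_comp_add_left (fun u => Real.exp (-(u ^ 2 / 2))), add_zero, gaussianTail]

theorem gaussianTail_nonneg (z : ℝ) : 0 ≤ gaussianTail z :=
  integral_nonneg fun _ => (Real.exp_pos _).le

theorem gaussianTail_pos (z : ℝ) : 0 < gaussianTail z := by
  rw [gaussianTail, setIntegral_pos_iff_support_of_nonneg_ae
    (Eventually.of_forall fun _ => (Real.exp_pos _).le) integrable_exp_neg_sq_half.integrableOn]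
  have : Function.support (fun u : ℝ => Real.exp (-(u ^ 2 / 2))) = Set.univ :=
    Set.eq_univ_of_forall fun u => (Real.exp_pos _).ne'
  rw [this, Set.univ_inter]
  simp

theorem gaussianTail_anti : Antitone gaussianTail := fun _ _ hab =>
  setIntegral_mono_set integrable_exp_neg_sq_half.integrableOn
    (Eventually.of_forall fun _ => (Real.exp_pos _).le) (Set.Ioi_subset_Ioi hab).eventuallyLE

/-- For r, h ≥ 0, (z + h + r)² ≥ (z + r)² + 2zh, whatever the sign of z. This is the source of all
the exponential bounds. -/
theorem gaussianTail_add_le (z : ℝ) {h : ℝ} (hh : 0 ≤ h) :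
    gaussianTail (z + h) ≤ gaussianTail z * Real.exp (-(z * h)) := by
  rw [gaussianTail_eq, gaussianTail_eq, ← integral_mul_const]
  have hint : ∀ z : ℝ, Integrable (fun r : ℝ => Real.exp (-((z + r) ^ 2 / 2))) := fun z =>
    integrable_exp_neg_sq_half.comp_add_left z
  refine setIntegral_mono_on (hint _).integrableOn ((hint _).mul_const _).integrableOn
    measurableSet_Ioi fun r hr => ?_
  have hr : 0 < r := hr
  rw [← Real.exp_add]
  refine Real.exp_le_exp.mpr ?_
  nlinarith [mul_nonneg hh hr.le, sq_nonneg h]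

/-- The asymptotic form of Mills' ratio. -/
theorem tendsto_mul_gaussianTail_mul_exp :
    Tendsto (fun z => z * gaussianTail z * Real.exp (z ^ 2 / 2)) atTop (𝓝 1) := by
  -- The substitution u = z + w/z turns exp(z²/2 - u²/2) into this integrand.
  have hlim : Tendsto (fun z : ℝ => ∫ w in Set.Ioi (0 : ℝ), Real.exp (-w - (z⁻¹ * w) ^ 2 / 2)) atTop
      (𝓝 (∫ w in Set.Ioi (0 : ℝ), Real.exp (-w))) := by
    refine tendsto_integral_filter_of_dominated_convergence (fun w => Real.exp (-w)) ?_ ?_ ?_ ?_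
    · exact Eventually.of_forall fun z => (by fun_prop :
        Continuous fun w : ℝ => Real.exp (-w - (z⁻¹ * w) ^ 2 / 2)).aestronglyMeasurable
    · refine Eventually.of_forall fun z => Eventually.of_forall fun w => ?_
      rw [Real.norm_of_nonneg (Real.exp_pos _).le]
      exact Real.exp_le_exp.mpr (by nlinarith [sq_nonneg (z⁻¹ * w)])
    · exact integrableOn_exp_neg_Ioi 0
    · refine Eventually.of_forall fun w => ?_
      have h1 : Tendsto (fun z : ℝ => -w - (z⁻¹ * w) ^ 2 / 2) atTop (𝓝 (-w - (0 * w) ^ 2 / 2)) :=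
        (((tendsto_inv_atTop_zero.mul_const w).pow 2).div_const 2).const_sub _
      simpa [Function.comp_def] using (Real.continuous_exp.tendsto _).comp h1
  rw [integral_exp_neg_Ioi_zero] at hlim
  refine hlim.congr' ?_
  filter_upwards [eventually_gt_atTop 0] with z hz
  have h := integral_comp_mul_left_Ioi
    (fun w : ℝ => Real.exp (-w - (z⁻¹ * w) ^ 2 / 2)) 0 hz
  rw [mul_zero, smul_eq_mul, eq_inv_mul_iff_mul_eq₀ hz.ne'] at h
  rw [← h, gaussianTail_eq, mul_assoc, ← integral_mul_const]
  congr 1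
  refine integral_congr_ae (Eventually.of_forall fun r => ?_)
  simp only
  rw [inv_mul_cancel_left₀ hz.ne', ← Real.exp_add]
  congr 1
  ring

theorem gaussianCDF_eq_real (m s x : ℝ) :
    gaussianCDF m s x = (gaussianReal m (.mk (s ^ 2) (sq_nonneg s))).real (Set.Iic x) :=
  cdf_eq_real (gaussianReal m (.mk (s ^ 2) (sq_nonneg s))) x

theorem one_sub_gaussianCDF (m : ℝ) {s : ℝ} (hs : 0 < s) (x : ℝ) :
    1 - gaussianCDF m s x = (√(2 * Real.pi))⁻¹ * gaussianTail ((x - m) / s) := by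
  have hmap : gaussianReal m (.mk (s ^ 2) (sq_nonneg s))
      = (gaussianReal 0 1).map (fun y => s * y + m) := by
    have h1 := gaussianReal_map_const_mul (μ := 0) (v := 1) s
    have h2 := gaussianReal_map_add_const (μ := s * 0) (v := .mk (s ^ 2) (sq_nonneg _) * 1) m
    rw [← h1, Measure.map_map (by fun_prop) (by fun_prop), mul_zero, zero_add, mul_one] at h2
    exact h2.symm
  have hpre : (fun y => s * y + m) ⁻¹' (Set.Iic x) = Set.Iic ((x - m) / s) := by
    ext y
    simp only [Set.mem_preimage, Set.mem_Iic, le_div_iff₀ hs]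
    constructor <;> intro h <;> linarith
  rw [gaussianCDF_eq_real, hmap, map_measureReal_apply (by fun_prop) measurableSet_Iic, hpre,
    ← probReal_compl_eq_one_sub measurableSet_Iic, Set.compl_Iic, measureReal_def,
    gaussianReal_apply_eq_integral 0 one_ne_zero, ENNReal.toReal_ofReal
      (integral_nonneg fun _ => gaussianPDFReal_nonneg _ _ _), gaussianTail, ← integral_const_mul]
  refine integral_congr_ae (Eventually.of_forall fun u => ?_)
  simp [gaussianPDFReal, neg_div]

/-- A Gaussian with smaller standard deviation, or with the same standard deviation and smaller
mean, has a negligible tail. -/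
theorem tendsto_gaussianTail_ratio {μg μb σg σb : ℝ} (hσb : 0 < σb)
    (hgood : σb < σg ∨ (σg = σb ∧ μb < μg)) :
    Tendsto (fun z => gaussianTail ((σg * z + μg - μb) / σb) / gaussianTail z) atTop (𝓝 0) := by
  -- A level z of the good state lies at least δ higher in units of the bad state: the gap grows
  -- linearly if σb < σg and is constant if the deviations agree.
  have hlin : ∃ δ > 0, ∀ᶠ z : ℝ in atTop, δ ≤ (σg * z + μg - μb) / σb - z := by
    rcases hgood with h | ⟨rfl, h⟩
    · refine ⟨1, one_pos, ?_⟩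
      have ht : Tendsto (fun z : ℝ => ((σg - σb) / σb) * z + (μg - μb) / σb) atTop atTop :=
        tendsto_atTop_add_const_right _ _
          (tendsto_id.const_mul_atTop (div_pos (sub_pos.mpr h) hσb))
      filter_upwards [ht.eventually_ge_atTop 1] with z hz
      refine hz.trans (le_of_eq ?_)
      field_simp
      ring
    · refine ⟨(μg - μb) / σg, div_pos (sub_pos.mpr h) hσb, Eventually.of_forall fun z => ?_⟩
      refine le_of_eq ?_
      field_simp
      ring
  obtain ⟨δ, hδ, hev⟩ := hlin
  have hexp : Tendsto (fun z : ℝ => Real.exp (-(z * δ))) atTop (𝓝 0) :=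
    Real.tendsto_exp_neg_atTop_nhds_zero.comp (tendsto_id.atTop_mul_const hδ)
  refine squeeze_zero' (Eventually.of_forall fun z =>
    div_nonneg (gaussianTail_nonneg _) (gaussianTail_nonneg _)) ?_ hexp
  filter_upwards [hev] with z hz
  rw [div_le_iff₀ (gaussianTail_pos z), mul_comm (Real.exp _)]
  exact (gaussianTail_anti (by linarith : z + δ ≤ _)).trans (gaussianTail_add_le z hδ.le)

/-! ### Gumbel levels -/

/-- The level, in standard units, whose exceedances by `exp (s ^ 2 / 2)` Gaussian variables with
weight proportional to `c⁻¹` are about `exp (-t)` in number. -/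
noncomputable def gumbelLevel (c s t : ℝ) : ℝ :=
  s + (t - Real.log (s * c)) / s

theorem tendsto_sub_log_div {c : ℝ} (hc : 0 < c) (t : ℝ) :
    Tendsto (fun s => (t - Real.log (s * c)) / s) atTop (𝓝 0) := by
  have h1 : Tendsto (fun s : ℝ => (t - Real.log c) / s) atTop (𝓝 0) :=
    tendsto_const_nhds.div_atTop tendsto_id
  have h2 : Tendsto (fun s : ℝ => Real.log s / s) atTop (𝓝 0) :=
    Real.isLittleO_log_id_atTop.tendsto_div_nhds_zero
  have h3 := h1.sub h2
  rw [sub_zero] at h3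
  refine h3.congr' ?_
  filter_upwards [eventually_gt_atTop 0] with s hs
  rw [Real.log_mul hs.ne' hc.ne', ← sub_div]
  congr 1
  ring

theorem tendsto_gumbelLevel_div {c : ℝ} (hc : 0 < c) (t : ℝ) :
    Tendsto (fun s => gumbelLevel c s t / s) atTop (𝓝 1) := by
  have h1 := ((tendsto_sub_log_div hc t).mul tendsto_inv_atTop_zero).const_add 1
  rw [mul_zero, add_zero] at h1
  refine h1.congr' ?_
  filter_upwards [eventually_gt_atTop 0] with s hs
  rw [gumbelLevel, add_div, div_self hs.ne', div_eq_mul_inv (_ / s)]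

theorem tendsto_gumbelLevel_atTop {c : ℝ} (hc : 0 < c) (t : ℝ) :
    Tendsto (fun s => gumbelLevel c s t) atTop atTop :=
  tendsto_atTop_add_right_of_le' atTop (-1) tendsto_id <| by
    filter_upwards [(tendsto_sub_log_div hc t).eventually (eventually_ge_nhds (by norm_num :
      (-1 : ℝ) < 0))] with s hs using hs

theorem gumbelLevel_add (c s t u : ℝ) :
    gumbelLevel c s (t + u) = gumbelLevel c s t + u / s := by
  rw [gumbelLevel, gumbelLevel]
  ring

/-- With d = (t - log(sc))/s and z = s + d, exp(s²/2) = exp(z²/2) exp(-d²/2) · sc · exp(-t). Mills'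
ratio applies at z, while d → 0 and z/s → 1. -/
theorem tendsto_exp_mul_gaussianTail {c : ℝ} (hc : 0 < c) (t : ℝ) :
    Tendsto (fun s => Real.exp (s ^ 2 / 2) * gaussianTail (gumbelLevel c s t)) atTop
      (𝓝 (c * Real.exp (-t))) := by
  have h1 := tendsto_mul_gaussianTail_mul_exp.comp (tendsto_gumbelLevel_atTop hc t)
  have h2 := (tendsto_gumbelLevel_div hc t).inv₀ one_ne_zero
  have h3 : Tendsto (fun s => Real.exp (-(((t - Real.log (s * c)) / s) ^ 2 / 2))) atTop (𝓝 1) := by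
    have := (Real.continuous_exp.tendsto _).comp
      (((tendsto_sub_log_div hc t).pow 2).div_const 2).neg
    simpa [Function.comp_def] using this
  have h4 := ((h1.mul h2).mul h3).mul_const (c * Real.exp (-t))
  rw [inv_one, one_mul, one_mul, one_mul] at h4
  refine h4.congr' ?_
  filter_upwards [eventually_gt_atTop 0,
    (tendsto_gumbelLevel_atTop hc t).eventually_gt_atTop 0] with s hs hz
  have hexp : Real.exp (s ^ 2 / 2)
      = Real.exp (gumbelLevel c s t ^ 2 / 2)
        * Real.exp (-(((t - Real.log (s * c)) / s) ^ 2 / 2)) * (s * c) * Real.exp (-t) := by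
    rw [← Real.exp_log (mul_pos hs hc), ← Real.exp_add, ← Real.exp_add, ← Real.exp_add]
    congr 1
    rw [Real.exp_log (mul_pos hs hc), gumbelLevel]
    field_simp
    ring
  rw [hexp]
  simp only [Function.comp_apply]
  field_simp

/-! ### Limits and uniform bounds for tails comparable to the Gaussian one -/

section Tail

variable {H : ℝ → ℝ} {ρ c : ℝ}

theorem tendsto_exp_mul_tail (hc : 0 < c) (hρ : ρ * c = 1)
    (hH : Tendsto (fun z => H z / gaussianTail z) atTop (𝓝 ρ)) (t : ℝ) :
    Tendsto (fun s => Real.exp (s ^ 2 / 2) * H (gumbelLevel c s t)) atTop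
      (𝓝 (Real.exp (-t))) := by
  have h1 := (tendsto_exp_mul_gaussianTail hc t).mul
    (hH.comp (tendsto_gumbelLevel_atTop hc t))
  have h2 : c * Real.exp (-t) * ρ = Real.exp (-t) := by linear_combination Real.exp (-t) * hρ
  rw [h2] at h1
  refine h1.congr fun s => ?_
  simp only [Function.comp_apply]
  rw [mul_assoc, mul_div_cancel₀ _ (gaussianTail_pos _).ne']

/-- Start from level z₀ at t = 0 and move up by t/s: the Gaussian tail loses a factor exp(-z₀t/s),
and z₀/s ≥ 1/2 eventually. -/
theorem exists_exp_mul_tail_le (hc : 0 < c)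
    (hH : Tendsto (fun z => H z / gaussianTail z) atTop (𝓝 ρ)) :
    ∃ A, ∀ᶠ s in atTop, ∀ t, 0 ≤ t →
      Real.exp (s ^ 2 / 2) * H (gumbelLevel c s t) ≤ A * Real.exp (-(t / 2)) := by
  have hρB : ρ < |ρ| + 1 := (le_abs_self ρ).trans_lt (lt_add_one _)
  obtain ⟨z₁, hz₁⟩ := eventually_atTop.mp (hH.eventually (eventually_le_nhds hρB))
  have h0 := tendsto_exp_mul_gaussianTail hc 0
  rw [neg_zero, Real.exp_zero, mul_one] at h0
  refine ⟨2 * c * (|ρ| + 1), ?_⟩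
  filter_upwards [eventually_gt_atTop 0,
    (tendsto_gumbelLevel_atTop hc 0).eventually_ge_atTop z₁,
    (tendsto_gumbelLevel_div hc 0).eventually (eventually_ge_nhds (by norm_num :
      (1 / 2 : ℝ) < 1)),
    h0.eventually (eventually_le_nhds (by linarith : c < 2 * c))] with s hs hlev hdiv hQ t ht
  have hlev_eq : gumbelLevel c s t = gumbelLevel c s 0 + t / s := by
    rw [← gumbelLevel_add, zero_add]
  have hts : 0 ≤ t / s := div_nonneg ht hs.le
  have h1 : H (gumbelLevel c s t) ≤ (|ρ| + 1) * gaussianTail (gumbelLevel c s t) :=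
    (div_le_iff₀ (gaussianTail_pos _)).mp (hz₁ _ (by rw [hlev_eq]; linarith))
  have h2 : gaussianTail (gumbelLevel c s t)
      ≤ gaussianTail (gumbelLevel c s 0) * Real.exp (-(t / 2)) := by
    rw [hlev_eq]
    refine (gaussianTail_add_le _ hts).trans
      (mul_le_mul_of_nonneg_left (Real.exp_le_exp.mpr ?_) (gaussianTail_nonneg _))
    have : gumbelLevel c s 0 * (t / s) = gumbelLevel c s 0 / s * t := by ring
    rw [this]
    nlinarith
  calc Real.exp (s ^ 2 / 2) * H (gumbelLevel c s t)
      ≤ Real.exp (s ^ 2 / 2) * ((|ρ| + 1) *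
          (gaussianTail (gumbelLevel c s 0) * Real.exp (-(t / 2)))) := by
        gcongr
        exact h1.trans (by gcongr)
    _ = (Real.exp (s ^ 2 / 2) * gaussianTail (gumbelLevel c s 0))
          * ((|ρ| + 1) * Real.exp (-(t / 2))) := by ring
    _ ≤ 2 * c * ((|ρ| + 1) * Real.exp (-(t / 2))) := by gcongr
    _ = _ := by ring

/-- The shift is now downwards, so the rate is governed by the lower level: it is z₀/s - t/s² ≥ 3/4
- 1/4 = 1/2, which is why t stops at s²/4. The prefactor is ρ · c/2 = 1/2. -/
theorem eventually_le_exp_mul_tail (hc : 0 < c) (hρ : ρ * c = 1)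
    (hH : ∀ z, ρ * gaussianTail z ≤ H z) :
    ∀ᶠ s in atTop, ∀ t, 0 ≤ t → t ≤ s ^ 2 / 4 →
      1 / 2 * Real.exp (t / 2) ≤ Real.exp (s ^ 2 / 2) * H (gumbelLevel c s (-t)) := by
  have hρ0 : 0 < ρ := by
    by_contra h
    nlinarith
  have h0 := tendsto_exp_mul_gaussianTail hc 0
  rw [neg_zero, Real.exp_zero, mul_one] at h0
  filter_upwards [eventually_gt_atTop 0,
    (tendsto_gumbelLevel_div hc 0).eventually (eventually_ge_nhds (by norm_num :
      (3 / 4 : ℝ) < 1)),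
    h0.eventually (eventually_ge_nhds (by linarith : c / 2 < c))] with s hs hdiv hQ t ht hts
  have hlev_eq : gumbelLevel c s 0 = gumbelLevel c s (-t) + t / s := by
    rw [← gumbelLevel_add, neg_add_cancel]
  have h1 := gaussianTail_add_le (gumbelLevel c s (-t)) (div_nonneg ht hs.le)
  rw [← hlev_eq] at h1
  have h2 : t / 2 ≤ gumbelLevel c s (-t) * (t / s) := by
    have h3 : gumbelLevel c s (-t) * (t / s) = (gumbelLevel c s 0 / s - t / s ^ 2) * t := by
      rw [hlev_eq]
      field_simp
      ring
    have h4 : t / s ^ 2 ≤ 1 / 4 := by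
      rw [div_le_iff₀ (by positivity)]
      linarith
    rw [h3]
    nlinarith
  have h5 : gaussianTail (gumbelLevel c s 0) * Real.exp (t / 2)
      ≤ gaussianTail (gumbelLevel c s (-t)) := by
    refine (mul_le_mul_of_nonneg_right h1 (Real.exp_pos _).le).trans ?_
    rw [mul_assoc, ← Real.exp_add]
    refine mul_le_of_le_one_right (gaussianTail_nonneg _) (Real.exp_le_one_iff.mpr ?_)
    linarith
  calc 1 / 2 * Real.exp (t / 2) = ρ * (c / 2 * Real.exp (t / 2)) := by
        linear_combination (-(1 / 2) * Real.exp (t / 2)) * hρ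
    _ ≤ ρ * (Real.exp (s ^ 2 / 2) * gaussianTail (gumbelLevel c s 0) * Real.exp (t / 2)) := by
        gcongr
    _ = Real.exp (s ^ 2 / 2) * (ρ * (gaussianTail (gumbelLevel c s 0) * Real.exp (t / 2))) := by
        ring
    _ ≤ Real.exp (s ^ 2 / 2) * (ρ * gaussianTail (gumbelLevel c s (-t))) := by gcongr
    _ ≤ Real.exp (s ^ 2 / 2) * H (gumbelLevel c s (-t)) := by gcongr; exact hH _

end Tail

/-- The remainder beyond the range of the lower tail bound is negligible. -/
theorem tendsto_quadratic_mul_exp_neg_exp (A B : ℝ) :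
    Tendsto (fun s : ℝ => (A * s + B * s ^ 2) * Real.exp (-(1 / 4 * Real.exp (s ^ 2 / 8)))) atTop
      (𝓝 0) := by
  have h1 : Tendsto (fun s : ℝ => |A| * (s ^ (1 : ℝ) * Real.exp (-(1 / 32) * s))
      + |B| * (s ^ (2 : ℝ) * Real.exp (-(1 / 32) * s))) atTop (𝓝 0) := by
    have := ((tendsto_rpow_mul_exp_neg_mul_atTop_nhds_zero 1 (1 / 32) (by norm_num)).const_mul
      |A|).add ((tendsto_rpow_mul_exp_neg_mul_atTop_nhds_zero 2 (1 / 32) (by norm_num)).const_mul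
      |B|)
    simpa using this
  refine squeeze_zero_norm' ?_ h1
  filter_upwards [eventually_ge_atTop 1] with s hs
  have h2 : Real.exp (-(1 / 4 * Real.exp (s ^ 2 / 8))) ≤ Real.exp (-(1 / 32) * s) := by
    -- For s ≥ 1, exp(s²/8)/4 ≥ s²/32 ≥ s/32.
    refine Real.exp_le_exp.mpr ?_
    nlinarith [Real.add_one_le_exp (s ^ 2 / 8)]
  rw [Real.rpow_one, Real.rpow_two, norm_mul, Real.norm_of_nonneg (Real.exp_pos _).le]
  have h3 : ‖A * s + B * s ^ 2‖ ≤ |A| * s + |B| * s ^ 2 := by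
    refine (norm_add_le _ _).trans (le_of_eq ?_)
    rw [Real.norm_eq_abs, Real.norm_eq_abs, abs_mul, abs_mul, abs_of_nonneg (by linarith : 0 ≤ s),
      abs_of_nonneg (sq_nonneg s)]
  calc ‖A * s + B * s ^ 2‖ * Real.exp (-(1 / 4 * Real.exp (s ^ 2 / 8)))
      ≤ (|A| * s + |B| * s ^ 2) * Real.exp (-(1 / 32) * s) := by gcongr
    _ = _ := by ring

/-! ### The capacity distribution and its normalizing constants -/

theorem stationary_pos_and_add {α β : ℝ} (hα : 0 ≤ α) (hβ : 0 ≤ β)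
    (hp : stationary α β .good ≠ 0) (hq : stationary α β .bad ≠ 0) :
    0 < stationary α β .good ∧ 0 < stationary α β .bad ∧
      stationary α β .good + stationary α β .bad = 1 := by
  -- Division by zero gives 0, so α + β = 0 would force p = 0.
  have hsum : α + β ≠ 0 := fun h => hp (by simp [stationary, h])
  refine ⟨lt_of_le_of_ne (div_nonneg hβ (by linarith)) hp.symm,
    lt_of_le_of_ne (div_nonneg hα (by linarith)) hq.symm, ?_⟩
  simp only [stationary]
  rw [← add_div, add_comm β α, div_self hsum]

/-- The tail of the capacity distribution, in standard units of the good state. -/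
noncomputable def capacityTail (α β μg μb σg σb : ℝ) (z : ℝ) : ℝ :=
  1 - capacityCDF α β μg μb σg σb (μg + σg * z)

theorem capacityTail_eq {α β μg μb σg σb : ℝ}
    (hpq : stationary α β .good + stationary α β .bad = 1) (hσg : 0 < σg) (hσb : 0 < σb) (z : ℝ) :
    capacityTail α β μg μb σg σb z = (√(2 * Real.pi))⁻¹ *
      (stationary α β .good * gaussianTail z
        + stationary α β .bad * gaussianTail ((σg * z + μg - μb) / σb)) := by
  have hg := one_sub_gaussianCDF μg hσg (μg + σg * z)
  have hb := one_sub_gaussianCDF μb hσb (μg + σg * z)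
  rw [add_sub_cancel_left, mul_div_cancel_left₀ _ hσg.ne'] at hg
  rw [add_comm μg] at hb
  rw [capacityTail, capacityCDF]
  rw [add_comm μg] at hg ⊢
  linear_combination stationary α β .good * hg + stationary α β .bad * hb - hpq

theorem mul_gaussianTail_le_capacityTail {α β μg μb σg σb : ℝ}
    (hpq : stationary α β .good + stationary α β .bad = 1) (hq : 0 < stationary α β .bad)
    (hσg : 0 < σg) (hσb : 0 < σb) (z : ℝ) :
    (√(2 * Real.pi))⁻¹ * stationary α β .good * gaussianTail z
      ≤ capacityTail α β μg μb σg σb z := by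
  rw [capacityTail_eq hpq hσg hσb, mul_assoc]
  gcongr
  exact le_add_of_nonneg_right (mul_nonneg hq.le (gaussianTail_nonneg _))

theorem tendsto_capacityTail_div_gaussianTail {α β μg μb σg σb : ℝ}
    (hpq : stationary α β .good + stationary α β .bad = 1)
    (hσg : 0 < σg) (hσb : 0 < σb) (hgood : σb < σg ∨ (σg = σb ∧ μb < μg)) :
    Tendsto (fun z => capacityTail α β μg μb σg σb z / gaussianTail z) atTop
      (𝓝 ((√(2 * Real.pi))⁻¹ * stationary α β .good)) := by
  have h := (((tendsto_gaussianTail_ratio hσb hgood).const_mul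
    (stationary α β .bad)).const_add (stationary α β .good)).const_mul (√(2 * Real.pi))⁻¹
  rw [mul_zero, add_zero] at h
  refine h.congr fun z => ?_
  have := (gaussianTail_pos z).ne'
  rw [capacityTail_eq hpq hσg hσb]
  field_simp

/-- Here c = √(2π)/p, and 2 log(sc) = log(2 log K · 2π/p²) = log log K + log(4π/p²). The identity is
exact, so no error from the constants has to be tracked. -/
theorem locConst_add_div_scaleConst {p μg σg : ℝ} (hp : 0 < p) {K : ℕ}
    (hK : 2 ≤ K) (t : ℝ) :
    locConst p μg σg K + t / scaleConst σg K
      = μg + σg * gumbelLevel (√(2 * Real.pi) / p) √(2 * Real.log K) t := by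
  have hlog : 0 < Real.log K := Real.log_pos (by exact_mod_cast hK)
  have hs : 0 < √(2 * Real.log K) := Real.sqrt_pos.mpr (by linarith)
  have hl : Real.log (√(2 * Real.log K) * (√(2 * Real.pi) / p))
      = (Real.log (Real.log K) + Real.log (4 * Real.pi / p ^ 2)) / 2 := by
    have hpi := Real.pi_pos
    rw [← Real.log_mul hlog.ne' (by positivity), eq_div_iff two_ne_zero, mul_comm _ (2 : ℝ)]
    have h := Real.log_pow (√(2 * Real.log K) * (√(2 * Real.pi) / p)) 2
    push_cast at h
    rw [← h, mul_pow, div_pow, Real.sq_sqrt (by linarith), Real.sq_sqrt (by linarith)]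
    congr 1
    ring
  rw [gumbelLevel, hl, locConst, scaleConst]
  field_simp
  ring

/-! ### Integrability and law of the maximum -/

section Maximum

variable {Ω : Type*} [MeasurableSpace Ω] {P : Measure Ω} {C : ℕ → Ω → ℝ}

theorem integrable_maxCapacity (hC : ∀ i, Integrable (C i) P) (K : ℕ) :
    Integrable (maxCapacity C K) P := by
  have hmeas : AEMeasurable (maxCapacity C K) P :=
    AEMeasurable.iSup fun i : Fin K => (hC i).aemeasurable
  refine (integrable_finsetSum Finset.univ fun (i : Fin K) _ => (hC i).abs).mono'
    hmeas.aestronglyMeasurable (Eventually.of_forall fun ω => ?_)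
  rw [Real.norm_eq_abs, maxCapacity]
  -- For K = 0 the supremum is over the empty family and equals 0.
  rcases isEmpty_or_nonempty (Fin K) with h | h
  · simp
  · obtain ⟨i, hi⟩ := exists_eq_ciSup_of_finite (f := fun i : Fin K => C i ω)
    rw [← hi]
    exact Finset.single_le_sum (f := fun i : Fin K => |C i ω|) (fun _ _ => abs_nonneg _)
      (Finset.mem_univ i)

theorem measureReal_maxCapacity_le (hindep : iIndepFun C P) {F : ℝ → ℝ}
    (hlaw : ∀ i x, P.real {ω | C i ω ≤ x} = F x) {K : ℕ} (hK : 0 < K) (x : ℝ) :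
    P.real {ω | maxCapacity C K ω ≤ x} = F x ^ K := by
  have hne : Nonempty (Fin K) := ⟨⟨0, hK⟩⟩
  have hset : {ω | maxCapacity C K ω ≤ x} = ⋂ i ∈ Finset.range K, C i ⁻¹' Set.Iic x := by
    ext ω
    simp only [Set.mem_iInter, Set.mem_preimage, Set.mem_Iic, Finset.mem_range]
    change (⨆ i : Fin K, C i ω) ≤ x ↔ _
    rw [ciSup_le_iff (Set.finite_range _).bddAbove]
    exact ⟨fun h i hi => h ⟨i, hi⟩, fun h i => h i i.2⟩
  have hlaw' : ∀ i, (P (C i ⁻¹' Set.Iic x)).toReal = F x := fun i => hlaw i x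
  rw [hset, measureReal_def, hindep.measure_inter_preimage_eq_mul (Finset.range K)
    (sets := fun _ => Set.Iic x) (fun _ _ => measurableSet_Iic), ENNReal.toReal_prod,
    Finset.prod_eq_pow_card fun i _ => hlaw' i, Finset.card_range]

/-- The distribution function determines the law of X as a mixture of two Gaussians, each with a
first moment. -/
theorem integrable_capacity [IsFiniteMeasure P] {α β μg μb σg σb : ℝ}
    (hp : 0 ≤ stationary α β .good)
    (hq : 0 ≤ stationary α β .bad) {X : Ω → ℝ} (hX : AEMeasurable X P)
    (hlaw : ∀ x, P.real {ω | X ω ≤ x} = capacityCDF α β μg μb σg σb x) : Integrable X P := by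
  have hmap : P.map X = ENNReal.ofReal (stationary α β .good) •
        gaussianReal μg (.mk (σg ^ 2) (sq_nonneg σg))
      + ENNReal.ofReal (stationary α β .bad) •
        gaussianReal μb (.mk (σb ^ 2) (sq_nonneg σb)) := by
    have : IsFiniteMeasure (P.map X) := inferInstance
    refine Measure.ext_of_Iic _ _ fun x => ?_
    rw [Measure.map_apply_of_aemeasurable hX measurableSet_Iic, Measure.add_apply,
      Measure.smul_apply, Measure.smul_apply, smul_eq_mul, smul_eq_mul]
    have h1 : P (X ⁻¹' Set.Iic x) = ENNReal.ofReal (P.real {ω | X ω ≤ x}) :=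
      (ofReal_measureReal (measure_ne_top _ _)).symm
    rw [h1, hlaw, capacityCDF, gaussianCDF_eq_real, gaussianCDF_eq_real,
      ENNReal.ofReal_add (mul_nonneg hp measureReal_nonneg) (mul_nonneg hq measureReal_nonneg),
      ENNReal.ofReal_mul hp, ENNReal.ofReal_mul hq, ofReal_measureReal, ofReal_measureReal]
  have hid : ∀ m s : ℝ, Integrable (fun x => x) (gaussianReal m (.mk (s ^ 2) (sq_nonneg s))) :=
    fun m s => memLp_one_iff_integrable.mp (memLp_id_gaussianReal 1)
  have : Integrable (fun x => x) (P.map X) := by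
    rw [hmap]
    exact ((hid _ _).smul_measure ENNReal.ofReal_ne_top).add_measure
      ((hid _ _).smul_measure ENNReal.ofReal_ne_top)
  exact this.comp_aemeasurable hX

end Maximum

/-! ### Limit law and mean of the normalized maximum -/

theorem tendsto_sqrt_two_mul_log : Tendsto (fun K : ℕ => √(2 * Real.log K)) atTop atTop :=
  Real.tendsto_sqrt_atTop.comp ((Real.tendsto_log_atTop.comp
    tendsto_natCast_atTop_atTop).const_mul_atTop two_pos)

theorem exp_sqrt_two_mul_log_sq_half {K : ℕ} (hK : 1 ≤ K) :
    Real.exp (√(2 * Real.log K) ^ 2 / 2) = K := by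
  have hK' : (1 : ℝ) ≤ K := by exact_mod_cast hK
  rw [Real.sq_sqrt (by linarith [Real.log_nonneg hK']), mul_div_cancel_left₀ _ two_ne_zero,
    Real.exp_log (by linarith)]

section Extreme

variable {Ω : Type*} [MeasurableSpace Ω] {P : Measure Ω} {C : ℕ → Ω → ℝ}
  {H : ℝ → ℝ} {c σ μ : ℝ} {b : ℕ → ℝ}

theorem measureReal_normalized_le (hσ : 0 < σ) (hindep : iIndepFun C P)
    (hlaw : ∀ i z, P.real {ω | C i ω ≤ μ + σ * z} = 1 - H z)
    (hb : ∀ K, 2 ≤ K → ∀ t,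
      b K + t / scaleConst σ K = μ + σ * gumbelLevel c √(2 * Real.log K) t)
    {K : ℕ} (hK : 2 ≤ K) (t : ℝ) :
    P.real {ω | scaleConst σ K * (maxCapacity C K ω - b K) ≤ t}
      = (1 - H (gumbelLevel c √(2 * Real.log K) t)) ^ K := by
  have hlog : 0 < Real.log K := Real.log_pos (by exact_mod_cast hK)
  have ha : 0 < scaleConst σ K := div_pos (Real.sqrt_pos.mpr (by linarith)) hσ
  have hset : {ω | scaleConst σ K * (maxCapacity C K ω - b K) ≤ t}
      = {ω | maxCapacity C K ω ≤ μ + σ * gumbelLevel c √(2 * Real.log K) t} := by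
    ext ω
    change scaleConst σ K * (maxCapacity C K ω - b K) ≤ t ↔
      maxCapacity C K ω ≤ μ + σ * gumbelLevel c √(2 * Real.log K) t
    rw [← hb K hK, ← sub_le_iff_le_add', le_div_iff₀' ha]
  have hlaw' : ∀ i x, P.real {ω | C i ω ≤ x} = 1 - H ((x - μ) / σ) := fun i x => by
    rw [← hlaw i, mul_div_cancel₀ _ hσ.ne', add_sub_cancel]
  rw [hset, measureReal_maxCapacity_le hindep hlaw' (by omega), add_sub_cancel_left,
    mul_div_cancel_left₀ _ hσ.ne']

/-- The remote lower tail of the normalized maximum is controlled by that of a single variable. -/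
theorem integral_remote_lower_tail_le [IsProbabilityMeasure P] (hσ : 0 < σ) (hindep : iIndepFun C P)
    (hC : Integrable (C 0) P)
    (hlaw : ∀ i z, P.real {ω | C i ω ≤ μ + σ * z} = 1 - H z)
    (hb : ∀ K, 2 ≤ K → ∀ t,
      b K + t / scaleConst σ K = μ + σ * gumbelLevel c √(2 * Real.log K) t)
    {K : ℕ} (hK : 2 ≤ K) {T : ℝ} (hT : 0 ≤ T) :
    ∫ t in Set.Ioi T, P.real {ω | scaleConst σ K * (maxCapacity C K ω - b K) ≤ -t}
      ≤ (1 - H (gumbelLevel c √(2 * Real.log K) (-T))) ^ (K - 1)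
        * (scaleConst σ K * ((∫ ω, |C 0 ω| ∂P) + |b K|)) := by
  have hlog : 0 < Real.log K := Real.log_pos (by exact_mod_cast hK)
  have hs : 0 < √(2 * Real.log K) := Real.sqrt_pos.mpr (by linarith)
  have ha : 0 < scaleConst σ K := div_pos hs hσ
  have hF0 : ∀ z, 0 ≤ 1 - H z := fun z => by
    rw [← hlaw 0]
    exact measureReal_nonneg
  have hFmono : Monotone fun z => 1 - H z := fun x y hxy => by
    simp only [← hlaw 0]
    refine measureReal_mono fun ω (hω : C 0 ω ≤ μ + σ * x) => ?_
    exact hω.trans (by gcongr)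
  have hX : Integrable (fun ω => scaleConst σ K * (C 0 ω - b K)) P :=
    (hC.sub (integrable_const _)).const_mul _
  have hone : ∀ t, P.real {ω | scaleConst σ K * (C 0 ω - b K) ≤ -t}
      = 1 - H (gumbelLevel c √(2 * Real.log K) (-t)) := fun t => by
    rw [← hlaw 0, ← hb K hK]
    congr 1
    ext ω
    change scaleConst σ K * (C 0 ω - b K) ≤ -t ↔ C 0 ω ≤ b K + -t / scaleConst σ K
    rw [← sub_le_iff_le_add', le_div_iff₀' ha]
  obtain ⟨hint, hle⟩ := integrableOn_lower_tail hX
  set D := (1 - H (gumbelLevel c √(2 * Real.log K) (-T))) ^ (K - 1) with hD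
  have hD0 : 0 ≤ D := pow_nonneg (hF0 _) _
  calc ∫ t in Set.Ioi T, P.real {ω | scaleConst σ K * (maxCapacity C K ω - b K) ≤ -t}
      ≤ ∫ t in Set.Ioi T, D * P.real {ω | scaleConst σ K * (C 0 ω - b K) ≤ -t} := by
        refine integral_mono_of_nonneg (Eventually.of_forall fun _ => measureReal_nonneg)
          ((hint.mono_set (Set.Ioi_subset_Ioi hT)).const_mul D) ?_
        refine (ae_restrict_iff' measurableSet_Ioi).mpr (Eventually.of_forall fun t ht => ?_)
        simp only
        -- One of the K factors is split off: the other K - 1 are bounded by monotonicity at -T, and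
        -- the one kept makes the bound integrable.
        rw [measureReal_normalized_le hσ hindep hlaw hb hK, hone,
          ← Nat.sub_add_cancel (by omega : 1 ≤ K), pow_succ, Nat.sub_add_cancel (by omega : 1 ≤ K)]
        refine mul_le_mul_of_nonneg_right (pow_le_pow_left₀ (hF0 _) (hFmono ?_) _) (hF0 _)
        rw [gumbelLevel, gumbelLevel]
        have ht : T < t := ht
        gcongr
    _ = D * ∫ t in Set.Ioi T, P.real {ω | scaleConst σ K * (C 0 ω - b K) ≤ -t} :=
        integral_const_mul _ _
    _ ≤ D * (scaleConst σ K * ((∫ ω, |C 0 ω| ∂P) + |b K|)) := by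
        refine mul_le_mul_of_nonneg_left ?_ hD0
        refine (setIntegral_mono_set hint (Eventually.of_forall fun _ => measureReal_nonneg)
          (Set.Ioi_subset_Ioi hT).eventuallyLE).trans (hle.trans ?_)
        have h1 : (∫ ω, |C 0 ω| ∂P) + |b K| = ∫ ω, (|C 0 ω| + |b K|) ∂P := by
          rw [integral_add hC.abs (integrable_const _)]
          simp
        rw [h1, ← integral_const_mul]
        refine integral_mono hX.abs ((hC.abs.add (integrable_const _)).const_mul _) fun ω => ?_
        simp only [abs_mul, abs_of_pos ha]
        exact mul_le_mul_of_nonneg_left (abs_sub _ _) ha.le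

theorem tendsto_normalized_max {ρ : ℝ} (hc : 0 < c) (hρ : ρ * c = 1)
    (hH : Tendsto (fun z => H z / gaussianTail z) atTop (𝓝 ρ)) (hσ : 0 < σ)
    (hindep : iIndepFun C P)
    (hlaw : ∀ i z, P.real {ω | C i ω ≤ μ + σ * z} = 1 - H z)
    (hb : ∀ K, 2 ≤ K → ∀ t,
      b K + t / scaleConst σ K = μ + σ * gumbelLevel c √(2 * Real.log K) t) (t : ℝ) :
    Tendsto (fun K : ℕ => P.real {ω | scaleConst σ K * (maxCapacity C K ω - b K) ≤ t}) atTop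
      (𝓝 (Real.exp (-Real.exp (-t)))) := by
  have h1 := ((tendsto_exp_mul_tail hc hρ hH t).comp tendsto_sqrt_two_mul_log).neg
  have h2 : Tendsto (fun K : ℕ => (K : ℝ) * -H (gumbelLevel c √(2 * Real.log K) t)) atTop
      (𝓝 (-Real.exp (-t))) := by
    refine h1.congr' ?_
    filter_upwards [eventually_ge_atTop 1] with K hK
    simp only [Function.comp_apply]
    rw [exp_sqrt_two_mul_log_sq_half hK, mul_neg]
  refine (Real.tendsto_one_add_pow_exp_of_tendsto h2).congr' ?_
  filter_upwards [eventually_ge_atTop 2] with K hK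
  rw [measureReal_normalized_le hσ hindep hlaw hb hK, sub_eq_add_neg]

theorem tendsto_integral_normalized_max [IsProbabilityMeasure P] {ρ : ℝ} (hc : 0 < c) (hρ : ρ * c = 1)
    (hH : Tendsto (fun z => H z / gaussianTail z) atTop (𝓝 ρ))
    (hHle : ∀ z, ρ * gaussianTail z ≤ H z) (hσ : 0 < σ)
    (hindep : iIndepFun C P) (hC : ∀ i, Integrable (C i) P)
    (hlaw : ∀ i z, P.real {ω | C i ω ≤ μ + σ * z} = 1 - H z)
    (hb : ∀ K, 2 ≤ K → ∀ t,
      b K + t / scaleConst σ K = μ + σ * gumbelLevel c √(2 * Real.log K) t) :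
    Tendsto (fun K : ℕ => ∫ ω, scaleConst σ K * (maxCapacity C K ω - b K) ∂P) atTop
      (𝓝 Real.eulerMascheroniConstant) := by
  have hF0 : ∀ z, 0 ≤ 1 - H z := fun z => by
    rw [← hlaw 0]
    exact measureReal_nonneg
  have hX : ∀ K, Integrable (fun ω => scaleConst σ K * (maxCapacity C K ω - b K)) P := fun K =>
    ((integrable_maxCapacity hC K).sub (integrable_const _)).const_mul _
  have hpow : ∀ (z : ℝ) (n : ℕ), (1 - H z) ^ n ≤ Real.exp (-(n * H z)) := fun z n => by
    rw [← mul_neg, Real.exp_nat_mul]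
    exact pow_le_pow_left₀ (hF0 z) (Real.one_sub_le_exp_neg _) n
  obtain ⟨A, hA⟩ := exists_exp_mul_tail_le (ρ := ρ) hc hH
  have hlow := eventually_le_exp_mul_tail hc hρ hHle
  have hT : Tendsto (fun K : ℕ => √(2 * Real.log K) ^ 2 / 4) atTop atTop :=
    ((tendsto_pow_atTop two_ne_zero).comp tendsto_sqrt_two_mul_log).atTop_div_const four_pos
  refine tendsto_integral_eulerMascheroniConstant hX
    (tendsto_normalized_max hc hρ hH hσ hindep hlaw hb) (A := A) (c := 1 / 2) (by norm_num) hT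
    ?_ ?_ ?_
  · filter_upwards [eventually_ge_atTop 2, tendsto_sqrt_two_mul_log.eventually hA]
      with K hK hKA t ht
    have hK' := hKA t ht
    rw [exp_sqrt_two_mul_log_sq_half (by omega)] at hK'
    have hcompl : P.real {ω | t < scaleConst σ K * (maxCapacity C K ω - b K)}
        = 1 - P.real {ω | scaleConst σ K * (maxCapacity C K ω - b K) ≤ t} := by
      rw [← probReal_compl_eq_one_sub₀
        (nullMeasurableSet_le (hX K).aemeasurable aemeasurable_const)]
      congr 1
      ext ω
      simp
    rw [hcompl, measureReal_normalized_le hσ hindep hlaw hb hK]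
    refine le_trans ?_ hK'
    -- Bernoulli's inequality gives 1 - (1 - H)^K ≤ K H.
    have := one_add_mul_le_pow (a := -H (gumbelLevel c √(2 * Real.log K) t))
      (by linarith [hF0 (gumbelLevel c √(2 * Real.log K) t)]) K
    rw [← sub_eq_add_neg 1 (H _)] at this
    linarith
  · filter_upwards [eventually_ge_atTop 2, tendsto_sqrt_two_mul_log.eventually hlow]
      with K hK hKl t ht htT
    have hK' := hKl t ht htT
    rw [exp_sqrt_two_mul_log_sq_half (by omega)] at hK'
    rw [measureReal_normalized_le hσ hindep hlaw hb hK]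
    exact (hpow _ K).trans (Real.exp_le_exp.mpr (neg_le_neg hK'))
  · have hlim := (tendsto_quadratic_mul_exp_neg_exp (σ⁻¹ * ((∫ ω, |C 0 ω| ∂P) + |μ|)) 2).comp
      tendsto_sqrt_two_mul_log
    refine squeeze_zero' (Eventually.of_forall fun K =>
      integral_nonneg fun _ => measureReal_nonneg) ?_ hlim
    have hlev := (tendsto_gumbelLevel_div hc 0).eventually (eventually_le_nhds (one_lt_two : (1 : ℝ) < 2))
    filter_upwards [eventually_ge_atTop 2, tendsto_sqrt_two_mul_log.eventually hlow,
      tendsto_sqrt_two_mul_log.eventually hlev,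
      tendsto_sqrt_two_mul_log.eventually
        ((tendsto_gumbelLevel_atTop hc 0).eventually_ge_atTop 0),
      tendsto_sqrt_two_mul_log.eventually_gt_atTop 0] with K hK hKl hlev2 hlev0 hs
    have hK' := hKl _ (by positivity) le_rfl
    rw [exp_sqrt_two_mul_log_sq_half (by omega)] at hK'
    refine (integral_remote_lower_tail_le hσ hindep (hC 0) hlaw hb hK (by positivity)).trans ?_
    have hb0 := hb K hK 0
    rw [zero_div, add_zero] at hb0
    simp only [Function.comp_apply]
    set s := √(2 * Real.log K)
    -- The level at t = 0 lies between 0 and 2s, so b_K = O(s); as a_K = s/σ, the cost of the single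
    -- variable is quadratic in s.
    have hbabs : |b K| ≤ |μ| + σ * (2 * s) := by
      rw [hb0]
      refine (abs_add_le _ _).trans ?_
      rw [abs_mul, abs_of_pos hσ, abs_of_nonneg hlev0]
      gcongr
      exact (div_le_iff₀ hs).mp hlev2
    have h1 : scaleConst σ K * ((∫ ω, |C 0 ω| ∂P) + |b K|)
        ≤ σ⁻¹ * ((∫ ω, |C 0 ω| ∂P) + |μ|) * s + 2 * s ^ 2 := by
      have ha : scaleConst σ K = s / σ := rfl
      calc scaleConst σ K * ((∫ ω, |C 0 ω| ∂P) + |b K|)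
          ≤ s / σ * ((∫ ω, |C 0 ω| ∂P) + (|μ| + σ * (2 * s))) := by
            rw [ha]
            gcongr
        _ = _ := by
            field_simp
            ring
    have h2 : (1 - H (gumbelLevel c s (-(s ^ 2 / 4)))) ^ (K - 1)
        ≤ Real.exp (-(1 / 4 * Real.exp (s ^ 2 / 8))) := by
      -- Since K - 1 ≥ K/2, the bound K H ≥ exp(s²/8)/2 at the cutoff leaves (K - 1) H ≥
      -- exp(s²/8)/4.
      refine (hpow _ _).trans (Real.exp_le_exp.mpr (neg_le_neg ?_))
      have hK2 : (2 : ℝ) ≤ K := by exact_mod_cast hK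
      have hcast : ((K - 1 : ℕ) : ℝ) = K - 1 := by
        rw [Nat.cast_sub (by omega), Nat.cast_one]
      have he : Real.exp (s ^ 2 / 4 / 2) = Real.exp (s ^ 2 / 8) := by
        congr 1
        ring
      rw [he] at hK'
      have hHpos : 0 ≤ H (gumbelLevel c s (-(s ^ 2 / 4))) := by
        by_contra hneg
        nlinarith [Real.exp_pos (s ^ 2 / 8)]
      rw [hcast]
      nlinarith
    rw [mul_comm]
    exact mul_le_mul h1 h2 (pow_nonneg (hF0 _) _) (by positivity)

end Extreme

end GilbertElliott

/-! ### Assembly -/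

theorem mainTheorem1
    (α β : ℝ) (hα : α ∈ Set.Icc (0 : ℝ) 1) (hβ : β ∈ Set.Icc (0 : ℝ) 1)
    (hp : GilbertElliott.stationary α β .good ≠ 0)
    (hq : GilbertElliott.stationary α β .bad ≠ 0)
    (μg μb σg σb : ℝ) (hσb : 0 < σb)
    (hgood : σb < σg ∨ (σg = σb ∧ μb < μg))
    {Ω : Type*} [MeasurableSpace Ω] (P : Measure Ω) [IsProbabilityMeasure P]
    (C : ℕ → Ω → ℝ) (hmeas : ∀ i, AEMeasurable (C i) P)
    (hindep : iIndepFun C P)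
    (hlaw : ∀ i x, P.real {ω | C i ω ≤ x}
      = GilbertElliott.capacityCDF α β μg μb σg σb x) :
    (∀ x : ℝ, Tendsto
      (fun K : ℕ => P.real {ω | GilbertElliott.scaleConst σg K *
        (GilbertElliott.maxCapacity C K ω
          - GilbertElliott.locConst (GilbertElliott.stationary α β .good) μg σg K) ≤ x})
      atTop (𝓝 (Real.exp (-Real.exp (-x))))) ∧
    (∀ K : ℕ, Integrable (GilbertElliott.maxCapacity C K) P) ∧
    (fun K : ℕ => (∫ ω, GilbertElliott.maxCapacity C K ω ∂P)
        - (GilbertElliott.locConst (GilbertElliott.stationary α β .good) μg σg K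
          + Real.eulerMascheroniConstant / GilbertElliott.scaleConst σg K))
      =o[atTop] (fun K : ℕ => 1 / GilbertElliott.scaleConst σg K) := by
  obtain ⟨hp0, hq0, hpq⟩ := GilbertElliott.stationary_pos_and_add hα.1 hβ.1 hp hq
  have hσg : 0 < σg := by
    rcases hgood with h | ⟨h, _⟩
    · exact hσb.trans h
    · exact h ▸ hσb
  have h2pi : 0 < √(2 * Real.pi) := Real.sqrt_pos.mpr (by positivity)
  have hc : 0 < √(2 * Real.pi) / GilbertElliott.stationary α β .good := div_pos h2pi hp0
  have hρ : (√(2 * Real.pi))⁻¹ * GilbertElliott.stationary α β .good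
      * (√(2 * Real.pi) / GilbertElliott.stationary α β .good) = 1 := by
    field_simp
  have hH := GilbertElliott.tendsto_capacityTail_div_gaussianTail hpq hσg hσb hgood
  have hHle := GilbertElliott.mul_gaussianTail_le_capacityTail (μg := μg) (μb := μb)
    hpq hq0 hσg hσb
  have hC : ∀ i, Integrable (C i) P := fun i =>
    GilbertElliott.integrable_capacity hp0.le hq0.le (hmeas i) (hlaw i)
  have hlaw' : ∀ i z, P.real {ω | C i ω ≤ μg + σg * z}
      = 1 - GilbertElliott.capacityTail α β μg μb σg σb z := fun i z => by
    rw [hlaw, GilbertElliott.capacityTail, sub_sub_cancel]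
  have hb : ∀ K, 2 ≤ K → ∀ t, _ := fun K hK t =>
    GilbertElliott.locConst_add_div_scaleConst (μg := μg) (σg := σg) hp0 (K := K) hK t
  refine ⟨GilbertElliott.tendsto_normalized_max hc hρ hH hσg hindep hlaw' hb,
    GilbertElliott.integrable_maxCapacity hC, ?_⟩
  have hmean := GilbertElliott.tendsto_integral_normalized_max hc hρ hH hHle hσg hindep hC hlaw' hb
  have hzero := hmean.sub_const Real.eulerMascheroniConstant
  rw [sub_self] at hzero
  -- E[M_K] - b_K - γ/a_K equals (1/a_K)(E[a_K(M_K - b_K)] - γ) once a_K ≠ 0, and the second factor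
  -- is o(1).
  have hprod := (isBigO_refl (fun K : ℕ => 1 / GilbertElliott.scaleConst σg K) atTop).mul_isLittleO
    ((isLittleO_one_iff ℝ).mpr hzero)
  refine hprod.congr' ?_ (Eventually.of_forall fun K => mul_one _)
  filter_upwards [GilbertElliott.tendsto_sqrt_two_mul_log.eventually_gt_atTop 0] with K hK
  have ha : GilbertElliott.scaleConst σg K ≠ 0 := (div_pos hK hσg).ne'
  rw [integral_const_mul, integral_sub (GilbertElliott.integrable_maxCapacity hC K)
    (integrable_const _), integral_const, probReal_univ, one_smul]
  field_simp
  ring
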